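/- Let $p \ge 7$ be a prime such that $2$ is a primitive root modulo $p$, and let $d$ denote the multiplicative order of $2$ modulo $p$ (so $d = p-1$). Let $G < \mathrm{GL}_p(\mathbb{Z})$ be a finite group which is irreducible, i.e. $\mathbb{Q}^p$ has no $G$-invariant $\mathbb{Q}$-subspaces other than $0$ and $\mathbb{Q}^p$. Put $G^+ = G \cap \mathrm{SL}_p(\mathbb{Z})$, let $O_2(G^+)$ be the largest normal $2$-subgroup of $G^+$, and suppose that $O_2(G^+)$ is elementary abelian of order $2^{d\ell}$ for some integer $1 \le \ell \le \frac{p-1}{d}$ (case (a) of Plesken's proposition). Then for every $G$-lattice $L \subseteq \mathbb{Z}^p$, i.e. every $G$-stable subgroup $L$ of $\mathbb{Z}^p$, $$\operatorname{symrank}(L, G) \le 2^p,$$ where $\operatorname{symrank}(L,G)$ is the minimal cardinality of a $G$-stable subset of $L$ that generates $L$ as an abelian group. -/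

import Mathlib

open scoped MatrixGroups

namespace SymRank

section GroupTheory

/-- `O_q(H)`: the subgroup of `H` generated by all normal `q`-subgroups of `H`. It is itself a
normal `q`-subgroup (see `pCore_normal` and `pCore_isPGroup`), hence the largest one. -/
def pCore (q : ℕ) (H : Type*) [Group H] : Subgroup H :=
  sSup {N : Subgroup H | N.Normal ∧ IsPGroup q N}

theorem le_pCore (q : ℕ) {H : Type*} [Group H] (N : Subgroup H) (hN : N.Normal)
    (hq : IsPGroup q N) : N ≤ pCore q H :=
  le_sSup ⟨hN, hq⟩

theorem directedOn_normal_isPGroup (q : ℕ) (H : Type*) [Group H] :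
    DirectedOn (· ≤ ·) {N : Subgroup H | N.Normal ∧ IsPGroup q N} := by
  rintro A ⟨hA, hA'⟩ B ⟨hB, hB'⟩
  exact ⟨A ⊔ B, ⟨inferInstance, hA'.to_sup_of_normal_right hB'⟩, le_sup_left, le_sup_right⟩

theorem mem_pCore (q : ℕ) {H : Type*} [Group H] (x : H) :
    x ∈ pCore q H ↔ ∃ N : Subgroup H, (N.Normal ∧ IsPGroup q N) ∧ x ∈ N :=
  (Subgroup.mem_sSup_of_directedOn (K := {N : Subgroup H | N.Normal ∧ IsPGroup q N})
    ⟨⊥, inferInstance, IsPGroup.of_bot⟩ (directedOn_normal_isPGroup q H))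

theorem pCore_normal (q : ℕ) (H : Type*) [Group H] : (pCore q H).Normal := by
  refine ⟨fun x hx g => ?_⟩
  obtain ⟨N, ⟨hN, hq⟩, hxN⟩ := (mem_pCore q x).1 hx
  exact (mem_pCore q _).2 ⟨N, ⟨hN, hq⟩, hN.conj_mem x hxN g⟩

theorem pCore_isPGroup (q : ℕ) (H : Type*) [Group H] : IsPGroup q (pCore q H) := by
  rintro ⟨x, hx⟩
  obtain ⟨N, ⟨-, hq⟩, hxN⟩ := (mem_pCore q x).1 hx
  obtain ⟨k, hk⟩ := hq ⟨x, hxN⟩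
  have hk' : x ^ q ^ k = 1 := congrArg Subtype.val hk
  exact ⟨k, Subtype.ext hk'⟩

/-- `A` is an elementary abelian `q`-group: it is abelian and every element satisfies `x ^ q = 1`. -/
def IsElementaryAbelian (q : ℕ) (A : Type*) [Group A] : Prop :=
  (∀ x y : A, x * y = y * x) ∧ ∀ x : A, x ^ q = 1

end GroupTheory

section IntegralMatrixGroups

/-- The representation of `G ≤ GL_n(ℤ)` on `ℚ ^ n = ℤ ^ n ⊗ ℚ` by matrix multiplication. -/
noncomputable def rationalRep {n : ℕ} (G : Subgroup (GL (Fin n) ℤ)) :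
    Representation ℚ G (Fin n → ℚ) :=
  (Matrix.toLinAlgEquiv' : Matrix (Fin n) (Fin n) ℚ ≃ₐ[ℚ] _).toAlgHom.toMonoidHom.comp
    ((Units.coeHom (Matrix (Fin n) (Fin n) ℚ)).comp
      ((Matrix.GeneralLinearGroup.map (Int.castRingHom ℚ)).comp G.subtype))

theorem rationalRep_apply {n : ℕ} (G : Subgroup (GL (Fin n) ℤ)) (g : G) (v : Fin n → ℚ) :
    rationalRep G g v =
      (((g : GL (Fin n) ℤ) : Matrix (Fin n) (Fin n) ℤ).map (Int.cast : ℤ → ℚ)).mulVec v :=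
  rfl

/-- The matrix group `G ≤ GL_n(ℤ)` is irreducible: `ℚ ^ n` is a simple `ℚ[G]`-module. -/
def IsIrreducibleGroup {n : ℕ} (G : Subgroup (GL (Fin n) ℤ)) : Prop :=
  (rationalRep G).IsIrreducible

/-- `G⁺ = G ∩ SL_n(ℤ)`. -/
def plusPart {n : ℕ} (G : Subgroup (GL (Fin n) ℤ)) : Subgroup (GL (Fin n) ℤ) :=
  G ⊓ (Matrix.GeneralLinearGroup.det : GL (Fin n) ℤ →* ℤˣ).ker

/-- Case (a) of Plesken's dichotomy for `G ≤ GL_p(ℤ)`: with `d` the multiplicative order of `2`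
modulo `p`, the group `O₂(G⁺)` is elementary abelian of order `2 ^ (d * l)` for some
`1 ≤ l ≤ (p - 1) / d`. (For an odd prime `p`, `d` divides `p - 1`, so the division is exact.) -/
def PleskenCaseA {p : ℕ} (G : Subgroup (GL (Fin p) ℤ)) : Prop :=
  IsElementaryAbelian 2 (pCore 2 (plusPart G)) ∧
    ∃ l : ℕ, 1 ≤ l ∧ l ≤ (p - 1) / orderOf (2 : ZMod p) ∧
      Nat.card (pCore 2 (plusPart G)) = 2 ^ (orderOf (2 : ZMod p) * l)

/-- A subset of `ℤ ^ n` is `G`-stable if `g v` lies in it for all its elements `v` and `g ∈ G`. -/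
def IsStable {n : ℕ} (G : Subgroup (GL (Fin n) ℤ)) (S : Set (Fin n → ℤ)) : Prop :=
  ∀ g ∈ G, ∀ v ∈ S, (g : Matrix (Fin n) (Fin n) ℤ).mulVec v ∈ S

/-- The symmetric rank of the `G`-lattice `L ⊆ ℤ ^ n`: the minimal cardinality (a natural number
or `⊤`) of a `G`-stable generating set of `L`. -/
noncomputable def symrank {n : ℕ} (L : Submodule ℤ (Fin n → ℤ)) (G : Subgroup (GL (Fin n) ℤ)) :
    ℕ∞ :=
  ⨅ (S : Set (Fin n → ℤ)) (_ : IsStable G S ∧ Submodule.span ℤ S = L), S.encard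

end IntegralMatrixGroups

end SymRank

/-!
Write `N = O₂(G⁺)`. As `2` is a primitive root, `N` is elementary abelian of order `2 ^ (p - 1)`.
Commuting involutions are simultaneously diagonalizable over `ℚ`, and there are only `2 ^ (p - 1)`
diagonal sign matrices of determinant `1`, so on some basis of `ℚ ^ p` the group `N` consists of all
of them (`exists_sign_change`). In particular it contains, for each `i`, the involution `n_i` that
fixes the `i`-th basis vector and negates all others, so the common eigenvectors of `N` are the
vectors on the coordinate lines. Since `G` normalizes `N`, it permutes these `p` lines
(`exists_monomial_basis`).

By irreducibility the lines are permuted transitively, so `p` divides `|G|`; an element of order `p`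
cannot fix every line, as its eigenvalues would be rational, hence equal to `1`. It therefore moves
the lines in one `p`-cycle, and the images of one vector form a basis `c` indexed by `ℤ/p`, shifted
cyclically by an element of `G` (`exists_cyclic_basis`).

Let `L` be a nonzero `G`-lattice and scale `c` so that `c_i` generates `L ∩ ℚ c_i`. For `v ∈ L` the
vector `v + n_i v` is twice the `i`-th component of `v`, so `L` lies between the span of the `c_i`
and half of it, and `G` acts by signed permutations of the `c_i`. In the basis `c_i / 2` the lattice
becomes one between `2 ℤ ^ p` and `ℤ ^ p`, that is, a cyclic binary code of length `p`. As `2` is a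
primitive root, `Φ_p` is irreducible modulo `2`, and such a code either contains the even-weight
code or has only constant words (`cyclic_code_dichotomy`). Together with the choice of scaling this
leaves `2 ℤ ^ p`, the root lattice `D_p` and `2 ℤ ^ p + ℤ (1, …, 1)`
(`exists_signedPermStable_span_eq`). They are generated by the `2 p` vectors `± 2 e_i`, the
`2 p (p - 1)` roots `± e_i ± e_j`, and the `2 ^ p` vectors `(± 1, …, ± 1)` respectively. These sets
are stable under signed permutations, and each has at most `2 ^ p` elements because `p ≥ 7`.
-/

namespace SymRank

/-! ### Cyclic binary codes of prime length -/

section CyclicCodes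
open Polynomial

theorem irreducible_cyclotomic_zmod_two {p : ℕ} (hp : p.Prime) (hp3 : 3 ≤ p)
    (h2 : IsPrimitiveRoot (2 : ZMod p) (p - 1)) :
    Irreducible (cyclotomic p (ZMod 2)) := by
  have hpn : ¬ 2 ∣ p := fun h => by
    have := (Nat.prime_dvd_prime_iff_eq Nat.prime_two hp).1 h
    omega
  refine ZMod.irreducible_of_dvd_cyclotomic_of_natDegree hpn dvd_rfl ?_
  rw [natDegree_cyclotomic, Nat.totient_prime hp, ← orderOf_units, h2.eq_orderOf]
  simp

/-- The cyclic shift of the coordinates of `ℤ ^ p`. -/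
def shift (p : ℕ) : (ZMod p → ℤ) →ₗ[ℤ] (ZMod p → ℤ) :=
  LinearMap.funLeft ℤ ℤ (fun i => i - 1)

theorem shift_single {p : ℕ} (i : ZMod p) (a : ℤ) :
    shift p (Pi.single i a) = Pi.single (i + 1) a := by
  ext j
  simp only [shift, LinearMap.funLeft_apply, Pi.single_apply, sub_eq_iff_eq_add]

theorem shift_pow_single {p : ℕ} (k : ℕ) (i : ZMod p) (a : ℤ) :
    (shift p ^ k) (Pi.single i a) = Pi.single (i + k) a := by
  induction k with
  | zero => simp
  | succ k ih => rw [pow_succ', Module.End.mul_apply, ih, shift_single, Nat.cast_succ, add_assoc]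

theorem aeval_shift_mem {p : ℕ} {C : Submodule ℤ (ZMod p → ℤ)}
    (hC : ∀ x ∈ C, shift p x ∈ C) (f : ℤ[X]) {x : ZMod p → ℤ} (hx : x ∈ C) :
    aeval (shift p) f x ∈ C := by
  have hpow : ∀ k : ℕ, (shift p ^ k) x ∈ C := fun k => by
    induction k with
    | zero => simpa
    | succ k ih => rw [pow_succ', Module.End.mul_apply]; exact hC _ ih
  rw [aeval_eq_sum_range, LinearMap.sum_apply]
  exact Submodule.sum_mem _ fun k _ => C.smul_mem _ (hpow k)

/-- The polynomial whose coefficients are the coordinates of a vector of `ℤ ^ p`. -/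
noncomputable def toPoly {p : ℕ} (x : ZMod p → ℤ) : ℤ[X] :=
  ∑ k ∈ Finset.range p, monomial k (x k)

theorem coeff_toPoly {p : ℕ} (x : ZMod p → ℤ) {k : ℕ} (hk : k < p) :
    (toPoly x).coeff k = x k := by
  simp [toPoly, coeff_monomial, hk]

theorem degree_toPoly_lt {p : ℕ} (x : ZMod p → ℤ) : (toPoly x).degree < p := by
  refine (degree_lt_iff_coeff_zero _ _).2 fun k hk => ?_
  have : ¬ k < p := not_lt.2 hk
  simp [toPoly, coeff_monomial, this]

theorem aeval_toPoly {p : ℕ} [NeZero p] (x : ZMod p → ℤ) :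
    aeval (shift p) (toPoly x) (Pi.single 0 1) = x := by
  have h : ∀ k, aeval (shift p) (monomial k (x k)) (Pi.single 0 1) =
      (Pi.single (k : ZMod p) (x k) : ZMod p → ℤ) := fun k => by
    rw [aeval_monomial, Module.End.mul_apply, shift_pow_single, zero_add]
    simp only [Module.algebraMap_end_apply, ← Pi.single_smul, smul_eq_mul, mul_one]
  rw [toPoly, map_sum, LinearMap.sum_apply, Finset.sum_congr rfl fun k _ => h k]
  have h2 : ∑ k ∈ Finset.range p, (Pi.single (k : ZMod p) (x k) : ZMod p → ℤ) =
      ∑ i : ZMod p, Pi.single i (x i) := by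
    refine Finset.sum_bij' (fun k _ => (k : ZMod p)) (fun i _ => i.val) ?_ ?_ ?_ ?_ ?_
    · simp
    · intro i _; simpa using ZMod.val_lt i
    · intro k hk; exact ZMod.val_cast_of_lt (Finset.mem_range.1 hk)
    · simp
    · simp
  rw [h2, Finset.univ_sum_single]

/-- Cyclic binary codes of prime length `p` with `2` a primitive root modulo `p`, written as
integral lattices containing `2 ℤ ^ p`: as `Φ_p` is irreducible modulo `2`, a code with a word
other than the two constant ones contains the generator `X - 1` of the even-weight code. -/
theorem cyclic_code_dichotomy {p : ℕ} (hp : p.Prime) (hp3 : 3 ≤ p)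
    (h2 : IsPrimitiveRoot (2 : ZMod p) (p - 1)) {C : Submodule ℤ (ZMod p → ℤ)}
    (hC : ∀ x ∈ C, shift p x ∈ C) (hC2 : ∀ x, (2 : ℤ) • x ∈ C) :
    Pi.single 1 1 - Pi.single 0 1 ∈ C ∨
      ∀ x ∈ C, ∀ i j, ((x i : ℤ) : ZMod 2) = ((x j : ℤ) : ZMod 2) := by
  have : Fact p.Prime := ⟨hp⟩
  refine or_iff_not_imp_right.2 fun hne => ?_
  push Not at hne
  obtain ⟨x, hx, i, j, hij⟩ := hne
  set φ := Int.castRingHom (ZMod 2) with hφ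
  have hφs : Function.Surjective φ := ZMod.intCast_surjective
  have hirr := irreducible_cyclotomic_zmod_two hp hp3 h2
  have hnd : ¬ cyclotomic p (ZMod 2) ∣ (toPoly x).map φ := by
    rintro ⟨q, hq⟩
    -- by degree, the cofactor is a constant, so all coefficients of `x` agree modulo `2`
    have hq0 : q.degree ≤ 0 := by
      by_cases hz : q = 0
      · simp [hz]
      have hlt : ((toPoly x).map φ).degree < p := degree_map_le.trans_lt (degree_toPoly_lt x)
      rw [hq, degree_mul, degree_cyclotomic, Nat.totient_prime hp,
        degree_eq_natDegree hz, ← Nat.cast_add, Nat.cast_lt] at hlt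
      rw [degree_eq_natDegree hz]
      exact_mod_cast (by omega : q.natDegree ≤ 0)
    rw [eq_C_of_degree_le_zero hq0] at hq
    have key : ∀ i : ZMod p, ((x i : ℤ) : ZMod 2) = q.coeff 0 := fun i => by
      have := congrArg (coeff · i.val) hq
      simp only [coeff_map, coeff_toPoly x (ZMod.val_lt i), coeff_mul_C, cyclotomic_prime,
        finsetSum_coeff, coeff_X_pow, ZMod.natCast_val, ZMod.cast_id', id] at this
      simpa [ZMod.val_lt i, hφ] using this
    exact hij ((key i).trans (key j).symm)
  obtain ⟨u, v, huv⟩ := (hirr.coprime_iff_not_dvd.2 hnd).symm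
  obtain ⟨U, rfl⟩ := map_surjective φ hφs u
  obtain ⟨V, rfl⟩ := map_surjective φ hφs v
  have hker : Polynomial.C (2 : ℤ) ∣ U * toPoly x + V * cyclotomic p ℤ - 1 := by
    refine (C_dvd_iff_dvd_coeff _ _).2 fun k => ?_
    have h0 : (U * toPoly x + V * cyclotomic p ℤ - 1).map φ = 0 := by
      rw [Polynomial.map_sub, Polynomial.map_add, Polynomial.map_mul, Polynomial.map_mul,
        map_cyclotomic, huv, Polynomial.map_one, sub_self]
    have hk := congrArg (coeff · k) h0
    rw [coeff_map, coeff_zero] at hk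
    exact (ZMod.intCast_zmod_eq_zero_iff_dvd _ 2).1 hk
  obtain ⟨W, hW⟩ := hker
  have hXp : cyclotomic p ℤ * (X - 1) = X ^ p - 1 := cyclotomic_prime_mul_X_sub_one ℤ p
  have hpoly : (X - 1 : ℤ[X]) =
      (X - 1) * U * toPoly x + V * (X ^ p - 1) - Polynomial.C 2 * (W * (X - 1)) := by
    rw [← hXp]; linear_combination (1 - X) * hW
  have hcyc : aeval (shift p) (X ^ p - 1 : ℤ[X]) (Pi.single 0 1) = 0 := by
    simp [shift_pow_single]
  have hX : aeval (shift p) (X - 1 : ℤ[X]) (Pi.single 0 1) =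
      Pi.single 1 1 - Pi.single 0 1 := by
    simp [shift_single]
  rw [← hX, hpoly, map_sub, map_add, map_mul, map_mul, map_mul _ V, map_mul _ (Polynomial.C 2), LinearMap.sub_apply,
    LinearMap.add_apply, Module.End.mul_apply, Module.End.mul_apply, Module.End.mul_apply,
    Module.End.mul_apply, hcyc,
    aeval_toPoly, map_zero, add_zero, aeval_C]
  exact C.sub_mem (aeval_shift_mem hC _ (aeval_shift_mem hC _ hx)) (hC2 _)

end CyclicCodes

/-! ### Three vector systems stable under signed permutations -/

section SignedPermutations

variable {ι : Type*}

/-- A set of integral vectors is stable under all signed permutations of the coordinates. -/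
def IsSignedPermStable (S : Set (ι → ℤ)) : Prop :=
  ∀ (π : Equiv.Perm ι) (ε : ι → ℤˣ), ∀ x ∈ S, (fun i => (ε i : ℤ) * x (π i)) ∈ S

/-- The vectors all of whose coordinates are `± 1`. -/
def signVectors (ι : Type*) : Set (ι → ℤ) :=
  Set.range fun (ε : ι → ℤˣ) i => (ε i : ℤ)

theorem signVectors_stable : IsSignedPermStable (signVectors ι) := by
  rintro π ε _ ⟨a, rfl⟩
  exact ⟨fun i => ε i * a (π i), by simp⟩

variable [DecidableEq ι]

theorem mul_single_perm (π : Equiv.Perm ι) (ε : ι → ℤˣ) (j : ι) (a : ℤ) :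
    (fun i => (ε i : ℤ) * (Pi.single j a : ι → ℤ) (π i)) =
      Pi.single (π.symm j) ((ε (π.symm j) : ℤ) * a) := by
  ext i
  by_cases h : i = π.symm j
  · subst h; simp
  · have h' : π i ≠ j := fun h' => h ((Equiv.eq_symm_apply π).2 h')
    simp [h, h']

theorem even_units_sub_units (a b : ℤˣ) : Even ((a : ℤ) - b) := by
  rcases Int.units_eq_one_or a with rfl | rfl <;> rcases Int.units_eq_one_or b with rfl | rfl <;>
    decide

theorem mem_of_forall_even [Fintype ι] {P : Submodule ℤ (ι → ℤ)} (hP : ∀ i, Pi.single i 2 ∈ P)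
    {x : ι → ℤ} (hx : ∀ i, Even (x i)) : x ∈ P := by
  rw [← Finset.univ_sum_single x]
  refine P.sum_mem fun i _ => ?_
  obtain ⟨t, ht⟩ := even_iff_two_dvd.1 (hx i)
  have : (Pi.single i (x i) : ι → ℤ) = t • Pi.single i 2 := by
    rw [← Pi.single_smul, ht, smul_eq_mul, mul_comm]
  rw [this]
  exact P.smul_mem _ (hP i)

/-- The vectors `± 2 e_i`. -/
def doubledUnitVectors (ι : Type*) [DecidableEq ι] : Set (ι → ℤ) :=
  Set.range fun a : ι × ℤˣ => Pi.single a.1 (a.2 * 2 : ℤ)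

/-- The vectors `± e_i ± e_j` with `i ≠ j`, the roots of type `D`. -/
def rootsD (ι : Type*) [DecidableEq ι] : Set (ι → ℤ) :=
  {x | ∃ i j, i ≠ j ∧ ∃ a b : ℤˣ, x = Pi.single i (a : ℤ) + Pi.single j (b : ℤ)}

theorem doubledUnitVectors_stable : IsSignedPermStable (doubledUnitVectors ι) := by
  rintro π ε _ ⟨⟨i, a⟩, rfl⟩
  refine ⟨(π.symm i, ε (π.symm i) * a), ?_⟩
  dsimp only
  rw [mul_single_perm, Units.val_mul, mul_assoc]

theorem rootsD_stable : IsSignedPermStable (rootsD ι) := by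
  rintro π ε _ ⟨i, j, hij, a, b, rfl⟩
  refine ⟨π.symm i, π.symm j, π.symm.injective.ne hij, ε (π.symm i) * a, ε (π.symm j) * b, ?_⟩
  have := congrArg₂ (· + ·) (mul_single_perm π ε i a) (mul_single_perm π ε j b)
  simp only [Units.val_mul]
  rw [← this]
  ext k
  simp [mul_add]

theorem encard_range_le {α β : Type*} [Finite α] (f : α → β) {n : ℕ} (h : Nat.card α ≤ n) :
    (Set.range f).encard ≤ n := by
  rw [← Set.image_univ]
  refine (Set.encard_image_le _ _).trans ?_
  rw [Set.encard_univ, ENat.card_eq_coe_natCard]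
  exact_mod_cast h

theorem two_mul_mul_pred_le_two_pow {n : ℕ} (hn : 7 ≤ n) : 2 * (n * (n - 1)) ≤ 2 ^ n := by
  induction n, hn using Nat.le_induction with
  | base => norm_num
  | succ n hn ih =>
    obtain ⟨m, rfl⟩ : ∃ m, n = m + 1 := ⟨n - 1, by omega⟩
    simp only [Nat.add_sub_cancel] at ih ⊢
    rw [pow_succ]
    nlinarith

theorem encard_doubledUnitVectors_le [Fintype ι] (h : 7 ≤ Fintype.card ι) :
    (doubledUnitVectors ι).encard ≤ 2 ^ Fintype.card ι := by
  have := encard_range_le (fun a : ι × ℤˣ => (Pi.single a.1 (a.2 * 2 : ℤ) : ι → ℤ))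
    (n := 2 ^ Fintype.card ι) (by
      rw [Nat.card_eq_fintype_card, Fintype.card_prod, Fintype.card_units_int]
      refine le_trans ?_ (two_mul_mul_pred_le_two_pow h)
      rw [mul_comm]
      exact Nat.mul_le_mul_left _ (Nat.le_mul_of_pos_right _ (by omega)))
  exact_mod_cast this

theorem encard_signVectors_le [Fintype ι] : (signVectors ι).encard ≤ 2 ^ Fintype.card ι := by
  have := encard_range_le (fun (ε : ι → ℤˣ) (i : ι) => (ε i : ℤ))
    (n := 2 ^ Fintype.card ι) (by
      rw [Nat.card_eq_fintype_card, Fintype.card_fun, Fintype.card_units_int])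
  exact_mod_cast this

theorem encard_rootsD_le [Fintype ι] (h : 7 ≤ Fintype.card ι) :
    (rootsD ι).encard ≤ 2 ^ Fintype.card ι := by
  let e := Fintype.equivFin ι
  -- unordered pairs of indices, counted as pairs `i < j`
  let f : (Σ j : Fin (Fintype.card ι), Fin j) × ℤˣ × ℤˣ → ι → ℤ := fun a =>
    Pi.single (e.symm ⟨a.1.2, a.1.2.2.trans a.1.1.2⟩) (a.2.1 : ℤ) +
      Pi.single (e.symm a.1.1) (a.2.2 : ℤ)
  have hsub : rootsD ι ⊆ Set.range f := by
    have key : ∀ i j, e i < e j → ∀ a b : ℤˣ,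
        (Pi.single i (a : ℤ) + Pi.single j (b : ℤ) : ι → ℤ) ∈ Set.range f :=
      fun i j hij a b => ⟨(⟨e j, ⟨e i, hij⟩⟩, a, b), by simp [f]⟩
    rintro _ ⟨i, j, hij, a, b, rfl⟩
    rcases lt_or_gt_of_ne (e.injective.ne hij) with h | h
    · exact key i j h a b
    · rw [add_comm]; exact key j i h b a
  have := encard_range_le f (n := 2 ^ Fintype.card ι) (by
    refine le_trans (le_of_eq ?_) (two_mul_mul_pred_le_two_pow h)
    rw [Nat.card_eq_fintype_card, Fintype.card_prod, Fintype.card_prod, Fintype.card_units_int,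
      Fintype.card_sigma]
    simp only [Fintype.card_fin]
    rw [Fin.sum_univ_eq_sum_range (fun i => i), ← Finset.sum_range_id_mul_two]
    ring)
  exact_mod_cast (Set.encard_le_encard hsub).trans this

end SignedPermutations

/-! ### Shift-stable lattices between `2 ℤ ^ p` and `ℤ ^ p` -/

section Lattices

/-- The lattices between `2 ℤ ^ p` and `ℤ ^ p`, containing no `e_i` and stable under the cyclic
shift, are `2 ℤ ^ p`, the root lattice `D_p` and `2 ℤ ^ p + ℤ (1, …, 1)`. -/
theorem exists_signedPermStable_span_eq {p : ℕ} (hp : p.Prime) (hp7 : 7 ≤ p)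
    (h2 : IsPrimitiveRoot (2 : ZMod p) (p - 1)) {C : Submodule ℤ (ZMod p → ℤ)}
    (hC : ∀ x ∈ C, shift p x ∈ C) (hC2 : ∀ i n, Pi.single i n ∈ C ↔ Even n) :
    ∃ S : Set (ZMod p → ℤ), IsSignedPermStable S ∧ Submodule.span ℤ S = C ∧
      S.encard ≤ 2 ^ p := by
  have : Fact p.Prime := ⟨hp⟩
  have hcard : Fintype.card (ZMod p) = p := ZMod.card p
  have heven : ∀ x : ZMod p → ℤ, (∀ i, Even (x i)) → x ∈ C := fun x hx =>
    mem_of_forall_even (fun i => (hC2 i 2).2 even_two) hx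
  rcases cyclic_code_dichotomy hp (by omega) h2 hC
    (fun x => heven _ fun i => by simp) with hd | hpar
  · refine ⟨rootsD _, rootsD_stable, ?_,
      (encard_rootsD_le (by omega)).trans_eq (by rw [hcard])⟩
    have hdk : ∀ k : ℕ, (Pi.single (k : ZMod p) 1 - Pi.single 0 1 : ZMod p → ℤ) ∈ C := fun k => by
      induction k with
      | zero => simp
      | succ k ih =>
        have := C.add_mem (hC _ ih) hd
        rw [map_sub, shift_single, shift_single, zero_add, sub_add_sub_cancel] at this
        rwa [Nat.cast_succ]
    have hdi : ∀ i : ZMod p, (Pi.single i 1 - Pi.single 0 1 : ZMod p → ℤ) ∈ C := fun i => by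
      simpa using hdk i.val
    apply le_antisymm
    · rw [Submodule.span_le]
      rintro _ ⟨i, j, -, a, b, rfl⟩
      have h1 : (Pi.single i (a : ℤ) + Pi.single j (b : ℤ) : ZMod p → ℤ) =
          (Pi.single i 1 - Pi.single 0 1) - (Pi.single j 1 - Pi.single 0 1) +
            (Pi.single i ((a : ℤ) - (1 : ℤˣ)) + Pi.single j ((b : ℤ) - (-1 : ℤˣ))) := by
        simp only [Pi.single_sub, Units.val_one, Units.val_neg, Pi.single_neg]
        abel
      rw [SetLike.mem_coe, h1]
      exact C.add_mem (C.sub_mem (hdi i) (hdi j)) (C.add_mem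
        ((hC2 _ _).2 (even_units_sub_units _ _)) ((hC2 _ _).2 (even_units_sub_units _ _)))
    · intro x hx
      have hx0 : x = ∑ i, x i • (Pi.single i 1 - Pi.single 0 1 : ZMod p → ℤ) +
          Pi.single 0 (∑ i, x i) := by
        conv_lhs => rw [← Finset.univ_sum_single x]
        have h0 : (Pi.single 0 (∑ i, x i) : ZMod p → ℤ) = ∑ i, Pi.single 0 (x i) :=
          map_sum (AddMonoidHom.single (fun _ => ℤ) (0 : ZMod p)) _ _
        simp only [h0, smul_sub, ← Pi.single_smul, smul_eq_mul, mul_one, Finset.sum_sub_distrib,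
          sub_add_cancel]
      -- the last term is then a multiple of `e_0` in `C`, so its coefficient is even
      have hs : Even (∑ i, x i) := by
        rw [← hC2 0]
        have := C.sub_mem hx (C.sum_mem fun i (_ : i ∈ Finset.univ) => C.smul_mem (x i) (hdi i))
        nth_rw 1 [hx0] at this
        rwa [add_sub_cancel_left] at this
      rw [hx0]
      refine Submodule.add_mem _ (Submodule.sum_mem _ fun i _ => Submodule.smul_mem _ _ ?_) ?_
      · rcases eq_or_ne i 0 with rfl | hi
        · simp
        · exact Submodule.subset_span ⟨i, 0, hi, 1, -1, by simp [sub_eq_add_neg, Pi.single_neg]⟩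
      · obtain ⟨t, ht⟩ := even_iff_two_dvd.1 hs
        have h3 : (Pi.single 0 (∑ i, x i) : ZMod p → ℤ) = t •
            ((Pi.single 0 ((1 : ℤˣ) : ℤ) + Pi.single 1 ((1 : ℤˣ) : ℤ)) +
              (Pi.single 0 ((1 : ℤˣ) : ℤ) + Pi.single 1 ((-1 : ℤˣ) : ℤ))) := by
          rw [add_add_add_comm, ← Pi.single_add, ← Pi.single_add, ht]
          simp only [Units.val_one, Units.val_neg, add_neg_cancel, Pi.single_zero, add_zero]
          rw [← Pi.single_smul, smul_eq_mul, mul_comm, one_add_one_eq_two]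
        rw [h3]
        exact Submodule.smul_mem _ _ (Submodule.add_mem _
          (Submodule.subset_span ⟨0, 1, zero_ne_one, 1, 1, rfl⟩)
          (Submodule.subset_span ⟨0, 1, zero_ne_one, 1, -1, rfl⟩))
  · have hpar' : ∀ x ∈ C, ∀ i j, Even (x i) → Even (x j) := fun x hx i j h => by
      have hiff := fun n : ℤ => ZMod.intCast_zmod_eq_zero_iff_dvd n 2
      exact even_iff_two_dvd.2 ((hiff _).1
        ((hpar x hx i j).symm.trans ((hiff _).2 (even_iff_two_dvd.1 h))))
    by_cases hall : ∀ x ∈ C, ∀ i, Even (x i)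
    · refine ⟨doubledUnitVectors _, doubledUnitVectors_stable, le_antisymm ?_ ?_,
        (encard_doubledUnitVectors_le (by omega)).trans_eq (by rw [hcard])⟩
      · rw [Submodule.span_le]
        rintro _ ⟨⟨i, a⟩, rfl⟩
        exact (hC2 _ _).2 (even_two.mul_left _)
      · exact fun x hx => mem_of_forall_even
          (fun i => Submodule.subset_span (Set.mem_range.2 ⟨(i, 1), by simp⟩)) (hall x hx)
    · push Not at hall
      obtain ⟨y, hy, j, hj⟩ := hall
      have hyodd : ∀ i, Odd (y i) := fun i =>
        Int.not_even_iff_odd.1 fun hi => hj (hpar' y hy i j hi)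
      have hunit : ∀ a : ℤˣ, Odd (a : ℤ) := fun a => by
        rcases Int.units_eq_one_or a with rfl | rfl <;> decide
      refine ⟨signVectors _, signVectors_stable, le_antisymm ?_ ?_,
        encard_signVectors_le.trans_eq (by rw [hcard])⟩
      · rw [Submodule.span_le]
        rintro _ ⟨a, rfl⟩
        have := C.add_mem (heven ((fun i => (a i : ℤ)) - y) fun i => (hunit _).sub_odd (hyodd i)) hy
        rwa [sub_add_cancel] at this
      · have hS2 : ∀ i, (Pi.single i 2 : ZMod p → ℤ) ∈ Submodule.span ℤ (signVectors (ZMod p)) :=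
          fun i => by
            have : (Pi.single i 2 : ZMod p → ℤ) = (fun _ => ((1 : ℤˣ) : ℤ)) -
                fun k => ((if k = i then -1 else 1 : ℤˣ) : ℤ) := by
              ext k
              by_cases hk : k = i
              · subst hk; simp
              · simp [hk]
            rw [this]
            exact Submodule.sub_mem _ (Submodule.subset_span ⟨_, rfl⟩)
              (Submodule.subset_span ⟨_, rfl⟩)
        intro x hx
        by_cases hx0 : Even (x 0)
        · exact mem_of_forall_even hS2 fun i => hpar' x hx 0 i hx0
        · have hxodd : ∀ i, Odd (x i) := fun i =>
            Int.not_even_iff_odd.1 fun hi => hx0 (hpar' x hx i 0 hi)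
          have := Submodule.add_mem _ (mem_of_forall_even hS2 (x := x - fun _ => ((1 : ℤˣ) : ℤ))
            fun i => (hxodd i).sub_odd (hunit 1))
            (Submodule.subset_span (R := ℤ) (s := signVectors (ZMod p)) ⟨fun _ => 1, rfl⟩)
          rwa [sub_add_cancel] at this

end Lattices

/-! ### Simultaneous diagonalization of involutions -/

section CommonEigenvectors
open Module

/-- A finite set of commuting involutions of a rational vector space is simultaneously
diagonalizable. -/
theorem span_common_eigenvectors {V : Type*} [AddCommGroup V] [Module ℚ V]
    (F : Finset (End ℚ V)) (hinv : ∀ f ∈ F, f * f = 1) (hcomm : ∀ f ∈ F, ∀ g ∈ F, f * g = g * f) :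
    Submodule.span ℚ {v : V | ∀ f ∈ F, f v = v ∨ f v = -v} = ⊤ := by
  classical
  induction F using Finset.induction_on with
  | empty => simp
  | insert f F hf ih =>
    rw [eq_top_iff, ← ih (fun g hg => hinv g (Finset.mem_insert_of_mem hg))
      (fun g hg h hh => hcomm g (Finset.mem_insert_of_mem hg) h (Finset.mem_insert_of_mem hh)),
      Submodule.span_le]
    intro v hv
    have hff : f (f v) = v := by
      rw [← End.mul_apply, hinv f (Finset.mem_insert_self _ _), End.one_apply]
    have hfg : ∀ g ∈ F, g (f v) = f (g v) := fun g hg => by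
      rw [← End.mul_apply, ← End.mul_apply,
        hcomm f (Finset.mem_insert_self _ _) g (Finset.mem_insert_of_mem hg)]
    have hv2 : v = (1 / 2 : ℚ) • (v + f v) + (1 / 2 : ℚ) • (v - f v) := by module
    rw [SetLike.mem_coe, hv2]
    refine Submodule.add_mem _ (Submodule.smul_mem _ _ (Submodule.subset_span ?_))
      (Submodule.smul_mem _ _ (Submodule.subset_span ?_))
    · intro g hg
      rcases Finset.mem_insert.1 hg with rfl | hg
      · left; rw [map_add, hff, add_comm]
      · rcases hv g hg with h | h
        · left; rw [map_add, hfg g hg, h]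
        · right; rw [map_add, hfg g hg, h, map_neg, neg_add]
    · intro g hg
      rcases Finset.mem_insert.1 hg with rfl | hg
      · right; rw [map_sub, hff, neg_sub]
      · rcases hv g hg with h | h
        · left; rw [map_sub, hfg g hg, h]
        · right; rw [map_sub, hfg g hg, h, map_neg]; abel

theorem exists_basis_of_span_eq_top {V ι : Type*} [AddCommGroup V] [Module ℚ V]
    (e : Basis ι ℚ V) {s : Set V} (hs : Submodule.span ℚ s = ⊤) :
    ∃ b : Basis ι ℚ V, ∀ i, b i ∈ s := by
  obtain ⟨t, hts, htspan, hli⟩ := exists_linearIndependent ℚ s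
  let b := Basis.mk hli (by rw [Subtype.range_coe, htspan, hs])
  refine ⟨b.reindex (b.indexEquiv e), fun i => ?_⟩
  rw [Basis.reindex_apply, Basis.mk_apply]
  exact hts (Subtype.coe_prop _)

end CommonEigenvectors

/-! ### Groups of sign changes -/

section SignGroups
open Module

/-- The action of `GL_n(ℤ)` on `ℚ ^ n` by matrix multiplication. -/
noncomputable def rationalAction (n : ℕ) : GL (Fin n) ℤ →* End ℚ (Fin n → ℚ) :=
  (Matrix.toLinAlgEquiv' : Matrix (Fin n) (Fin n) ℚ ≃ₐ[ℚ] _).toAlgHom.toMonoidHom.comp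
    ((Units.coeHom (Matrix (Fin n) (Fin n) ℚ)).comp
      (Matrix.GeneralLinearGroup.map (Int.castRingHom ℚ)))

theorem rationalAction_apply {n : ℕ} (g : GL (Fin n) ℤ) (v : Fin n → ℚ) :
    rationalAction n g v = ((g : Matrix (Fin n) (Fin n) ℤ).map (Int.cast : ℤ → ℚ)).mulVec v :=
  rfl

theorem rationalAction_intCast {n : ℕ} (g : GL (Fin n) ℤ) (v : Fin n → ℤ) :
    rationalAction n g (fun i => (v i : ℚ)) =
      fun i => (((g : Matrix (Fin n) (Fin n) ℤ).mulVec v i : ℤ) : ℚ) := by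
  ext i
  simp [rationalAction_apply, Matrix.mulVec, dotProduct]

theorem rationalAction_injective (n : ℕ) : Function.Injective (rationalAction n) := by
  intro g h hgh
  refine Units.ext (Matrix.ext_of_mulVec_single fun i => ?_)
  have := congrArg (fun f : End ℚ (Fin n → ℚ) => f (fun k => ((Pi.single i 1 : Fin n → ℤ) k : ℚ)))
    hgh
  simp only [rationalAction_intCast] at this
  ext k
  exact_mod_cast congrFun this k

theorem det_rationalAction {n : ℕ} (g : GL (Fin n) ℤ) :
    LinearMap.det (rationalAction n g) = ((g : Matrix (Fin n) (Fin n) ℤ).det : ℚ) := by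
  have : rationalAction n g =
      Matrix.toLin' ((g : Matrix (Fin n) (Fin n) ℤ).map (Int.cast : ℤ → ℚ)) := rfl
  rw [this, LinearMap.det_toLin']
  exact (RingHom.map_det (Int.castRingHom ℚ) _).symm

theorem card_ker_prod_signs (n : ℕ) (hn : 1 ≤ n) :
    Nat.card (∏ i, Pi.evalMonoidHom (fun _ : Fin n => ℤˣ) i).ker = 2 ^ (n - 1) := by
  set P := ∏ i, Pi.evalMonoidHom (fun _ : Fin n => ℤˣ) i with hP
  have hsurj : Function.Surjective P := fun a => by
    refine ⟨Pi.mulSingle ⟨0, hn⟩ a, ?_⟩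
    simp [hP, MonoidHom.finsetProd_apply]
  have h1 := P.ker.card_mul_index
  rw [Subgroup.index_ker, MonoidHom.range_eq_top.2 hsurj, Subgroup.card_top,
    Nat.card_eq_fintype_card (α := ℤˣ), Fintype.card_units_int,
    Nat.card_eq_fintype_card (α := Fin n → ℤˣ), Fintype.card_fun, Fintype.card_units_int,
    Fintype.card_fin] at h1
  obtain ⟨m, rfl⟩ : ∃ m, n = m + 1 := ⟨n - 1, by omega⟩
  rw [pow_succ] at h1
  simpa using Nat.eq_of_mul_eq_mul_right two_pos h1

/-- A diagonal group of signs of determinant `1` and order `2 ^ (n - 1)` contains all such sign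
matrices, in particular the one with a single entry `1`, whose determinant is `(-1) ^ (n - 1)`. -/
theorem exists_sign_change {n : ℕ} (hn : Odd n) {N : Subgroup (GL (Fin n) ℤ)}
    (hdet : ∀ g ∈ N, (g : Matrix (Fin n) (Fin n) ℤ).det = 1) (hcard : Nat.card N = 2 ^ (n - 1))
    (b : Basis (Fin n) ℚ (Fin n → ℚ))
    (hb : ∀ g ∈ N, ∀ i, rationalAction n g (b i) = b i ∨ rationalAction n g (b i) = -b i)
    (i : Fin n) :
    ∃ g ∈ N, rationalAction n g (b i) = b i ∧ ∀ j ≠ i, rationalAction n g (b j) = -b j := by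
  have hε : ∀ (g : N) (i), ∃ ε : ℤˣ, rationalAction n g (b i) = ((ε : ℤ) : ℚ) • b i :=
    fun g i => by
      rcases hb g g.2 i with h | h
      · exact ⟨1, by simpa using h⟩
      · exact ⟨-1, by simpa using h⟩
  choose ε hε using hε
  have hinj : ∀ (i) (a c : ℤˣ), ((a : ℤ) : ℚ) • b i = ((c : ℤ) : ℚ) • b i → a = c :=
    fun i a c h => by
      have := smul_left_injective ℚ (b.ne_zero i) h
      exact Units.ext (by exact_mod_cast this)
  let E : N →* (Fin n → ℤˣ) := MonoidHom.mk' ε fun g h => funext fun i => hinj i _ _ <| by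
    rw [← hε, Subgroup.coe_mul, map_mul, End.mul_apply, hε h, map_smul, hε g, smul_smul,
      Pi.mul_apply, Units.val_mul, Int.cast_mul, mul_comm]
  have hE : Function.Injective E := fun g h hgh => by
    refine Subtype.ext (rationalAction_injective n (b.ext fun i => ?_))
    rw [hε, hε, show ε g = ε h from hgh]
  have hle : E.range ≤ (∏ i, Pi.evalMonoidHom (fun _ : Fin n => ℤˣ) i).ker := by
    rintro _ ⟨g, rfl⟩
    have hmat : LinearMap.toMatrix b b (rationalAction n g) =
        Matrix.diagonal fun i => ((ε g i : ℤ) : ℚ) := by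
      ext i j
      rw [LinearMap.toMatrix_apply, hε, map_smul, Finsupp.smul_apply, Basis.repr_self,
        Matrix.diagonal_apply, Finsupp.single_apply]
      by_cases h : i = j
      · subst h; simp
      · simp [h, Ne.symm h]
    have hd := det_rationalAction (g : GL (Fin n) ℤ)
    rw [hdet g g.2, ← LinearMap.det_toMatrix b, hmat, Matrix.det_diagonal] at hd
    rw [MonoidHom.mem_ker, MonoidHom.finsetProd_apply]
    change ∏ i, ε g i = 1
    norm_cast at hd
    exact Units.val_eq_one.1 hd
  have heq : E.range = (∏ i, Pi.evalMonoidHom (fun _ : Fin n => ℤˣ) i).ker := by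
    refine Subgroup.eq_of_le_of_card_ge hle ?_
    rw [card_ker_prod_signs n hn.pos, ← hcard]
    exact (Nat.card_congr (MonoidHom.ofInjective hE).toEquiv).le
  have hmem : (fun j => if j = i then 1 else -1 : Fin n → ℤˣ) ∈ E.range := by
    rw [heq, MonoidHom.mem_ker, MonoidHom.finsetProd_apply]
    simp only [Pi.evalMonoidHom_apply]
    rw [← Finset.mul_prod_erase _ _ (Finset.mem_univ i), if_pos rfl, one_mul,
      Finset.prod_congr rfl fun j hj => if_neg (Finset.ne_of_mem_erase hj), Finset.prod_const,
      Finset.card_erase_of_mem (Finset.mem_univ i), Finset.card_univ, Fintype.card_fin]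
    exact (Nat.Odd.sub_odd hn odd_one).neg_one_pow
  obtain ⟨g, hg⟩ := hmem
  have hg' : ∀ j, ε g j = if j = i then 1 else -1 := fun j => congrFun hg j
  exact ⟨g, g.2, by simp [hε, hg'], fun j hj => by simp [hε, hg', hj]⟩

/-- A common eigenvector of the sign changes lies on one of the coordinate lines. -/
theorem exists_smul_of_common_eigenvector {V ι : Type*} [AddCommGroup V] [Module ℚ V]
    (b : Basis ι ℚ V) {F : Set (End ℚ V)}
    (hF : ∀ i, ∃ f ∈ F, f (b i) = b i ∧ ∀ j ≠ i, f (b j) = -b j) {v : V} (hv0 : v ≠ 0)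
    (hv : ∀ f ∈ F, f v = v ∨ f v = -v) : ∃ i, ∃ c : ℚ, v = c • b i := by
  obtain ⟨i, hi⟩ : ∃ i, b.repr v i ≠ 0 := by
    by_contra! h
    exact hv0 (b.repr.map_eq_zero_iff.1 (Finsupp.ext h))
  obtain ⟨f, hfF, hfi, hfj⟩ := hF i
  -- `v + f v` is twice the component of `v` along `b i`
  have key : v + f v = (2 * b.repr v i) • b i := by
    have : LinearMap.id + f = (2 : ℚ) • (b.coord i).smulRight (b i) := b.ext fun j => by
      classical
      by_cases hj : j = i
      · subst hj
        simp [hfi, two_smul]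
      · simp [hfj j hj, hj]
    have := LinearMap.congr_fun this v
    simpa [mul_smul] using this
  rcases hv f hfF with h | h
  · refine ⟨i, b.repr v i, ?_⟩
    rw [h, mul_smul, ← two_smul ℚ v] at key
    exact smul_right_injective V (two_ne_zero (α := ℚ)) key
  · rw [h, add_neg_cancel] at key
    exact absurd key.symm (smul_ne_zero (mul_ne_zero two_ne_zero hi) (b.ne_zero i))

end SignGroups

/-! ### `O₂(G⁺)` as a matrix group -/

section PCore

theorem map_mem_pCore (q : ℕ) {H : Type*} [Group H] (φ : H ≃* H) {x : H} (hx : x ∈ pCore q H) :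
    φ x ∈ pCore q H := by
  obtain ⟨N, ⟨hN, hq⟩, hxN⟩ := (mem_pCore q x).1 hx
  exact (mem_pCore q _).2 ⟨N.map φ.toMonoidHom, ⟨hN.map _ φ.surjective, hq.map _⟩,
    Subgroup.mem_map_of_mem _ hxN⟩

/-- `O₂(G⁺)` as a group of matrices. -/
def plusCore {n : ℕ} (G : Subgroup (GL (Fin n) ℤ)) : Subgroup (GL (Fin n) ℤ) :=
  (pCore 2 (plusPart G)).map (plusPart G).subtype

theorem conj_mem_plusCore {n : ℕ} {G : Subgroup (GL (Fin n) ℤ)} {g : GL (Fin n) ℤ} (hg : g ∈ G)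
    {h : GL (Fin n) ℤ} (hh : h ∈ plusCore G) : g * h * g⁻¹ ∈ plusCore G := by
  obtain ⟨x, hx, rfl⟩ := hh
  have hgn : g ∈ Subgroup.normalizer (plusPart G : Set (GL (Fin n) ℤ)) := by
    rw [Subgroup.mem_normalizer_iff]
    intro k
    simp only [plusPart, Subgroup.mem_inf, MonoidHom.mem_ker, map_mul, map_inv,
      mul_inv_cancel_comm]
    rw [Subgroup.mul_mem_cancel_right _ (G.inv_mem hg), Subgroup.mul_mem_cancel_left _ hg]
  exact ⟨_, map_mem_pCore 2 ((plusPart G).normalizerMonoidHom ⟨g, hgn⟩) hx, rfl⟩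

end PCore

/-! ### Irreducible monomial representations of prime degree -/

section MonomialRepresentations
open Module

variable {Γ V ι : Type*} [Group Γ] [AddCommGroup V] [Module ℚ V] (ρ : Representation ℚ Γ V)
  (b : Basis ι ℚ V)

/-- A group permuting the lines spanned by the vectors of a basis acts on the index set. -/
theorem exists_mulAction_lines (h : ∀ g i, ∃ j, ∃ c : ℚ, ρ g (b i) = c • b j) :
    ∃ _ : MulAction Γ ι, ∀ (g : Γ) (i : ι), ∃ c : ℚ, c ≠ 0 ∧ ρ g (b i) = c • b (g • i) := by
  choose σ c hσ using h
  have hc : ∀ g i, c g i ≠ 0 := fun g i h0 => by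
    have h1 : ρ g⁻¹ (ρ g (b i)) = b i := ρ.inv_self_apply g (b i)
    rw [hσ, h0, zero_smul, map_zero] at h1
    exact b.ne_zero i h1.symm
  have huniq : ∀ {i j : ι} {a d : ℚ}, a ≠ 0 → a • b i = d • b j → i = j := by
    intro i j a d ha h
    by_contra hij
    have := congrArg (fun v => b.repr v i) h
    simp [Ne.symm hij] at this
    exact ha this
  refine ⟨{ smul := σ, mul_smul := fun g h i => ?_, one_smul := fun i => ?_ },
    fun g i => ⟨c g i, hc g i, hσ g i⟩⟩
  · change σ (g * h) i = σ g (σ h i)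
    refine huniq (hc (g * h) i) (d := c h i * c g (σ h i)) ?_
    rw [← hσ, map_mul, End.mul_apply, hσ h, map_smul, hσ g, smul_smul]
  · change σ 1 i = i
    refine huniq (hc 1 i) (d := 1) ?_
    rw [← hσ, map_one, End.one_apply, one_smul]

theorem isPretransitive_of_isIrreducible [ρ.IsIrreducible] [MulAction Γ ι]
    (h : ∀ (g : Γ) (i : ι), ∃ c : ℚ, c ≠ 0 ∧ ρ g (b i) = c • b (g • i)) :
    MulAction.IsPretransitive Γ ι := by
  refine ⟨fun i k => ?_⟩
  -- the span of the lines in the orbit of `i` is a nonzero subrepresentation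
  let W : Subrepresentation ρ :=
    { toSubmodule := Submodule.span ℚ (b '' MulAction.orbit Γ i)
      apply_mem_toSubmodule := fun g v hv => by
        induction hv using Submodule.span_induction with
        | mem x hx =>
          obtain ⟨j, hj, rfl⟩ := hx
          obtain ⟨c, -, hc⟩ := h g j
          rw [hc]
          exact Submodule.smul_mem _ _ (Submodule.subset_span
            ⟨_, MulAction.mem_orbit_of_mem_orbit g hj, rfl⟩)
        | zero => simp
        | add x y _ _ hx hy => rw [map_add]; exact Submodule.add_mem _ hx hy
        | smul a x _ hx => rw [map_smul]; exact Submodule.smul_mem _ _ hx }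
  have hi : b i ∈ W.toSubmodule :=
    Submodule.subset_span ⟨i, MulAction.mem_orbit_self i, rfl⟩
  rcases eq_bot_or_eq_top W with hW | hW
  · rw [hW] at hi
    exact absurd hi (b.ne_zero i)
  · have hk : b k ∈ W.toSubmodule := by rw [hW]; exact Submodule.mem_top
    exact b.self_mem_span_image.1 hk

/-- An irreducible faithful monomial group of odd prime degree `p` contains an element of order
`p`, and the images of one line under its powers are all the lines. -/
theorem exists_cyclic_basis [Finite Γ] [ρ.IsIrreducible] (hρ : Function.Injective ρ) {p : ℕ}
    (hp : p.Prime) (hodd : Odd p) [Finite ι] (hι : Nat.card ι = p)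
    (h : ∀ g i, ∃ j, ∃ c : ℚ, ρ g (b i) = c • b j) :
    ∃ (τ : Γ) (c : Basis (ZMod p) ℚ V), (∀ k, ρ τ (c k) = c (k + 1)) ∧
      ∃ (e : ZMod p ≃ ι) (u : ZMod p → ℚ), ∀ k, u k ≠ 0 ∧ c k = u k • b (e k) := by
  have : Fact p.Prime := ⟨hp⟩
  obtain ⟨_, hA⟩ := exists_mulAction_lines ρ b h
  have := isPretransitive_of_isIrreducible ρ b hA
  have hne : Nonempty ι := (Nat.card_pos_iff.1 (hι ▸ hp.pos)).1
  obtain ⟨i₀⟩ := hne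
  have hdvd : p ∣ Nat.card Γ := by
    rw [← hι, ← MulAction.index_stabilizer_of_transitive Γ i₀]
    exact Subgroup.index_dvd_card _
  obtain ⟨τ, hτ⟩ := exists_prime_orderOf_dvd_card' p hdvd
  have hτp : τ ^ p = 1 := hτ ▸ pow_orderOf_eq_one τ
  obtain ⟨i, hi⟩ : ∃ i : ι, τ • i ≠ i := by
    by_contra! hfix
    -- otherwise `τ` is diagonal with rational eigenvalues of odd order, so trivial
    have h1 : ρ τ = ρ 1 := b.ext fun i => by
      obtain ⟨c, -, hc⟩ := hA τ i
      rw [hfix] at hc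
      have hpow : ∀ n : ℕ, ρ (τ ^ n) (b i) = c ^ n • b i := fun n => by
        induction n with
        | zero => simp
        | succ n ih => rw [pow_succ, map_mul, End.mul_apply, hc, map_smul, ih, smul_smul, pow_succ,
            mul_comm]
      have h2 := hpow p
      rw [hτp, map_one, End.one_apply] at h2
      have h3 : c ^ p = 1 :=
        smul_left_injective ℚ (b.ne_zero i) (h2.symm.trans (one_smul ℚ _).symm)
      have h4 : c = 1 := hodd.strictMono_pow.injective (by rw [h3, one_pow])
      rw [hc, h4, map_one, End.one_apply, one_smul]
    exact hp.ne_one (hτ ▸ (orderOf_eq_one_iff.2 (hρ h1)))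
  have hper : MulAction.period τ i = p := by
    have h1 := MulAction.period_dvd_orderOf τ i
    rw [hτ] at h1
    exact ((Nat.dvd_prime hp).1 h1).resolve_left fun h => hi (MulAction.period_eq_one_iff.1 h)
  let f : ZMod p → ι := fun k => τ ^ k.val • i
  have hf : Function.Injective f := fun k l hkl => by
    refine ZMod.val_injective p ?_
    refine Function.iterate_injOn_Iio_minimalPeriod (f := (τ • ·)) (x := i) ?_ ?_ ?_
    · exact (ZMod.val_lt k).trans_eq hper.symm
    · exact (ZMod.val_lt l).trans_eq hper.symm
    · simpa [smul_iterate_apply] using hkl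
  have hbij : Function.Bijective f :=
    (Nat.bijective_iff_injective_and_card f).2 ⟨hf, by rw [Nat.card_zmod, hι]⟩
  choose u hu0 hu using fun k : ZMod p => hA (τ ^ k.val) i
  let e : ZMod p ≃ ι := Equiv.ofBijective f hbij
  let c : Basis (ZMod p) ℚ V := (b.reindex e.symm).isUnitSMul fun k => (hu0 k).isUnit
  have hc : ∀ k, c k = u k • b (e k) := fun k => by
    rw [Basis.isUnitSMul_apply, Basis.reindex_apply, Equiv.symm_symm]
  have hc' : ∀ k, c k = ρ (τ ^ k.val) (b i) := fun k => by rw [hc, hu]; rfl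
  refine ⟨τ, c, fun k => ?_, e, u, fun k => ⟨hu0 k, hc k⟩⟩
  have hval : τ ^ (k + 1).val = τ * τ ^ k.val := by
    rw [ZMod.val_add, ZMod.val_one, ← pow_succ', ← pow_eq_pow_mod _ hτp]
  rw [hc', hc', hval, map_mul, End.mul_apply]

end MonomialRepresentations

/-! ### Lattices of monomial groups -/

section Normalization
open Module

/-- The inclusion of `ℤ ^ n` into `ℚ ^ n`. -/
def castVec (n : ℕ) : (Fin n → ℤ) →ₗ[ℤ] (Fin n → ℚ) :=
  (Int.castAddHom ℚ).toIntLinearMap.compLeft (Fin n)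

theorem castVec_injective (n : ℕ) : Function.Injective (castVec n) := fun _ _ h =>
  funext fun i => Int.cast_injective (congrFun h i)

theorem rationalAction_castVec {n : ℕ} (g : GL (Fin n) ℤ) (v : Fin n → ℤ) :
    rationalAction n g (castVec n v) = castVec n ((g : Matrix (Fin n) (Fin n) ℤ).mulVec v) :=
  rationalAction_intCast g v

theorem rationalAction_mem_map {n : ℕ} {G : Subgroup (GL (Fin n) ℤ)}
    {L : Submodule ℤ (Fin n → ℤ)} (hL : IsStable G (L : Set (Fin n → ℤ))) {g : GL (Fin n) ℤ}
    (hg : g ∈ G) {v : Fin n → ℚ} (hv : v ∈ L.map (castVec n)) :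
    rationalAction n g v ∈ L.map (castVec n) := by
  obtain ⟨x, hx, rfl⟩ := hv
  exact ⟨_, hL g hg x hx, (rationalAction_castVec g x).symm⟩

theorem rationalAction_mem_map_iff {n : ℕ} {G : Subgroup (GL (Fin n) ℤ)}
    {L : Submodule ℤ (Fin n → ℤ)} (hL : IsStable G (L : Set (Fin n → ℤ))) {g : GL (Fin n) ℤ}
    (hg : g ∈ G) {v : Fin n → ℚ} :
    rationalAction n g v ∈ L.map (castVec n) ↔ v ∈ L.map (castVec n) := by
  refine ⟨fun h => ?_, rationalAction_mem_map hL hg⟩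
  have := rationalAction_mem_map hL (G.inv_mem hg) h
  rwa [← End.mul_apply, ← map_mul, inv_mul_cancel, map_one, End.one_apply] at this

/-- An integral lattice meets a rational line in a cyclic group. -/
theorem exists_line_generator {n : ℕ} (L : Submodule ℤ (Fin n → ℤ)) {v : Fin n → ℚ} (hv : v ≠ 0)
    {s : ℚ} (hs : s ≠ 0) (hsv : s • v ∈ L.map (castVec n)) :
    ∃ r : ℚ, r ≠ 0 ∧ ∀ t : ℚ, (t * r) • v ∈ L.map (castVec n) ↔ ∃ m : ℤ, t = m := by
  obtain ⟨k, hk⟩ : ∃ k, v k ≠ 0 := by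
    by_contra! h
    exact hv (funext h)
  -- the multiples of `v` in the lattice are determined by their integral `k`-th coordinates
  let A : Submodule ℤ ℤ := (L.map (castVec n)).comap (LinearMap.toSpanSingleton ℤ _ ((v k)⁻¹ • v))
  have hA : ∀ m : ℤ, m ∈ A ↔ ((m : ℚ) * (v k)⁻¹) • v ∈ L.map (castVec n) := fun m => by
    rw [Submodule.mem_comap, LinearMap.toSpanSingleton_apply, ← Int.cast_smul_eq_zsmul ℚ,
      smul_smul]
  have hint : ∀ c : ℚ, c • v ∈ L.map (castVec n) → ∃ m ∈ A, c = m * (v k)⁻¹ := fun c hc => by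
    obtain ⟨x, -, hx⟩ := id hc
    have hxk : (x k : ℚ) = c * v k := congrFun hx k
    have hcx : c = x k * (v k)⁻¹ := by rw [hxk, mul_inv_cancel_right₀ hk]
    exact ⟨x k, (hA _).2 (hcx ▸ hc), hcx⟩
  obtain ⟨a, ha⟩ := (IsPrincipalIdealRing.principal A).principal
  have ha' : ∀ m : ℤ, m ∈ A ↔ ∃ t : ℤ, t * a = m := fun m => by
    conv_lhs => rw [ha]
    exact Submodule.mem_span_singleton
  have ha0 : a ≠ 0 := by
    rintro rfl
    obtain ⟨m, hm, hsm⟩ := hint s hsv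
    obtain ⟨t, rfl⟩ := (ha' m).1 hm
    simp at hsm
    exact hs hsm
  have ha0' : (a : ℚ) * (v k)⁻¹ ≠ 0 := mul_ne_zero (Int.cast_ne_zero.2 ha0) (inv_ne_zero hk)
  refine ⟨a * (v k)⁻¹, ha0', fun t => ⟨fun h => ?_, ?_⟩⟩
  · obtain ⟨m, hm, htm⟩ := hint _ h
    obtain ⟨w, rfl⟩ := (ha' m).1 hm
    refine ⟨w, mul_right_cancel₀ ha0' ?_⟩
    rw [htm, Int.cast_mul, mul_assoc]
  · rintro ⟨m, rfl⟩
    rw [← mul_assoc, ← Int.cast_mul, ← hA]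
    exact (ha' _).2 ⟨m, rfl⟩

/-- The symmetric rank of a nonzero lattice of a group which is monomial on a basis of `ℚ ^ p`,
permutes this basis cyclically by one of its elements, and contains the sign changes of all but
one of the basis vectors. -/
theorem symrank_le_of_monomial {p : ℕ} (hp : p.Prime) (hp7 : 7 ≤ p)
    (h2 : IsPrimitiveRoot (2 : ZMod p) (p - 1)) {G : Subgroup (GL (Fin p) ℤ)}
    {L : Submodule ℤ (Fin p → ℤ)} (hL : IsStable G (L : Set (Fin p → ℤ))) (hL0 : L ≠ ⊥)
    (c : Basis (ZMod p) ℚ (Fin p → ℚ))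
    (hmon : ∀ (g : G) k, ∃ j, ∃ a : ℚ, rationalRep G g (c k) = a • c j)
    (hsign : ∀ k, ∃ g ∈ G, rationalAction p g (c k) = c k ∧
      ∀ j ≠ k, rationalAction p g (c j) = -c j)
    {τ : GL (Fin p) ℤ} (hτG : τ ∈ G) (hτ : ∀ k, rationalAction p τ (c k) = c (k + 1)) :
    symrank L G ≤ 2 ^ p := by
  have : Fact p.Prime := ⟨hp⟩
  set M := L.map (castVec p) with hM
  have hdouble : ∀ v ∈ M, ∀ k, (2 * c.repr v k) • c k ∈ M := fun v hv k => by
    obtain ⟨g, hgG, hgk, hgj⟩ := hsign k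
    have h1 : LinearMap.id + rationalAction p g = (2 : ℚ) • (c.coord k).smulRight (c k) :=
      c.ext fun j => by
        by_cases hj : j = k
        · subst hj
          simp [hgk, two_smul]
        · simp [hgj j hj, hj]
    have h2 := LinearMap.congr_fun h1 v
    have h3 : v + rationalAction p g v = (2 * c.repr v k) • c k := by
      simpa [mul_smul] using h2
    rw [← h3]
    exact M.add_mem hv (rationalAction_mem_map hL hgG hv)
  have hτk : ∀ (k : ℕ) (t : ℚ), t • c k ∈ M ↔ t • c 0 ∈ M := fun k t => by
    induction k with
    | zero => simp
    | succ k ih =>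
      rw [← ih, Nat.cast_succ, ← hτ, ← map_smul]
      exact rationalAction_mem_map_iff hL hτG
  have hτz : ∀ (k : ZMod p) (t : ℚ), t • c k ∈ M ↔ t • c 0 ∈ M := fun k t => by
    have := hτk k.val t
    rwa [ZMod.natCast_zmod_val] at this
  obtain ⟨r, hr0, hr⟩ : ∃ r : ℚ, r ≠ 0 ∧ ∀ t : ℚ, (t * r) • c 0 ∈ M ↔ ∃ m : ℤ, t = m := by
    obtain ⟨x, hxL, hx0⟩ := Submodule.exists_mem_ne_zero_of_ne_bot hL0
    obtain ⟨k, hk⟩ : ∃ k, c.repr (castVec p x) k ≠ 0 := by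
      by_contra! h
      exact hx0 (castVec_injective p
        ((c.repr.map_eq_zero_iff.1 (Finsupp.ext h)).trans (map_zero _).symm))
    exact exists_line_generator L (c.ne_zero 0) (mul_ne_zero two_ne_zero hk)
      ((hτz k _).1 (hdouble _ ⟨x, hxL, rfl⟩ k))
  have hr' : ∀ (t : ℚ) k, (t * r) • c k ∈ M ↔ ∃ m : ℤ, t = m := fun t k =>
    (hτz k _).trans (hr t)
  -- integral vectors are the coordinates of the lattice in the basis `(r / 2) c`
  let θ : (ZMod p → ℤ) →ₗ[ℤ] (Fin p → ℚ) :=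
    Fintype.linearCombination ℤ fun k => (r / 2) • c k
  have hθs : ∀ k (n : ℤ), θ (Pi.single k n) = ((n : ℚ) / 2 * r) • c k := fun k n => by
    simp only [θ, Fintype.linearCombination_apply_single, ← Int.cast_smul_eq_zsmul ℚ, smul_smul]
    congr 1; ring
  have hθ : ∀ x, θ x = ∑ k, ((x k : ℚ) / 2 * r) • c k := fun x => by
    conv_lhs => rw [← Finset.univ_sum_single x, map_sum]
    simp only [hθs]
  have hC1 : ∀ x ∈ M.comap θ, shift p x ∈ M.comap θ := fun x hx => by
    have h1 : θ (shift p x) = rationalAction p τ (θ x) := by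
      rw [hθ, hθ, map_sum, ← Equiv.sum_comp (Equiv.addRight (1 : ZMod p))]
      refine Finset.sum_congr rfl fun k _ => ?_
      rw [map_smul, hτ]
      simp [shift, LinearMap.funLeft_apply]
    rw [Submodule.mem_comap, h1]
    exact rationalAction_mem_map hL hτG hx
  have hC2 : ∀ i n, Pi.single i n ∈ M.comap θ ↔ Even n := fun i n => by
    rw [Submodule.mem_comap, hθs, hr', even_iff_two_dvd]
    refine exists_congr fun m => ?_
    rw [div_eq_iff two_ne_zero, mul_comm 2 m]
    exact_mod_cast Iff.rfl
  have hrange : M ≤ LinearMap.range θ := fun v hv => by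
    have h1 : ∀ k, ∃ m : ℤ, c.repr v k = (m : ℚ) / 2 * r := fun k => by
      have := hdouble v hv k
      rw [← div_mul_cancel₀ (2 * c.repr v k) hr0, hr'] at this
      obtain ⟨m, hm⟩ := this
      refine ⟨m, ?_⟩
      rw [← hm]; field_simp
    choose m hm using h1
    refine ⟨m, ?_⟩
    rw [hθ, ← c.sum_repr v]
    simp only [← hm, c.sum_repr]
  obtain ⟨S, hSstab, hSspan, hScard⟩ := exists_signedPermStable_span_eq hp hp7 h2 hC1 hC2
  have himage : castVec p '' (castVec p ⁻¹' (θ '' S)) = θ '' S := by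
    refine Set.image_preimage_eq_of_subset ?_
    rintro _ ⟨x, hx, rfl⟩
    have : x ∈ M.comap θ := hSspan ▸ Submodule.subset_span hx
    obtain ⟨y, -, hy⟩ := this
    exact ⟨y, hy⟩
  have hbound : (castVec p ⁻¹' (θ '' S)).encard ≤ 2 ^ p := by
    rw [← (castVec_injective p).encard_image, himage]
    exact (Set.encard_image_le _ _).trans hScard
  refine (iInf₂_le _ ⟨?_, ?_⟩).trans hbound
  · obtain ⟨_, hA⟩ := exists_mulAction_lines (rationalRep G) c hmon
    rintro g hg v ⟨x, hx, hxv⟩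
    -- `g` permutes the generators of the intersections of the lattice with the lines up to sign
    have hunit : ∀ k, ∃ ε : ℤˣ,
        rationalAction p g (c k) = ((ε : ℤ) : ℚ) • c ((⟨g, hg⟩ : G) • k) := fun k => by
      obtain ⟨a, ha0, ha⟩ := hA ⟨g, hg⟩ k
      replace ha : rationalAction p g (c k) = a • c ((⟨g, hg⟩ : G) • k) := ha
      have hiff : ∀ t : ℚ, (∃ m : ℤ, t * a = m) ↔ ∃ m : ℤ, t = m := fun t => by
        rw [← hr' t k, ← rationalAction_mem_map_iff hL hg, map_smul, ha, smul_smul,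
          mul_right_comm, hr']
      obtain ⟨m, hm⟩ := (hiff 1).2 ⟨1, by simp⟩
      obtain ⟨m', hm'⟩ := (hiff a⁻¹).1 ⟨1, by simp [ha0]⟩
      rw [one_mul] at hm
      have hmm : m * m' = 1 := by
        have : (m : ℚ) * m' = 1 := by rw [← hm, ← hm', mul_inv_cancel₀ ha0]
        exact_mod_cast this
      exact ⟨Units.mkOfMulEqOne m m' hmm, by rw [ha, hm]; rfl⟩
    choose ε hε using hunit
    let π : Equiv.Perm (ZMod p) := MulAction.toPerm (⟨g, hg⟩ : G)
    refine ⟨_, hSstab π.symm (fun j => ε (π.symm j)) x hx, ?_⟩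
    rw [← rationalAction_castVec, ← hxv, hθ, hθ, map_sum, ← Equiv.sum_comp π]
    refine Finset.sum_congr rfl fun k _ => ?_
    rw [map_smul, hε, smul_smul, Equiv.symm_apply_apply]
    have : π k = (⟨g, hg⟩ : G) • k := rfl
    rw [this]
    congr 1
    push_cast
    ring
  · refine Submodule.map_injective_of_injective (castVec_injective p) ?_
    rw [Submodule.map_span, himage, ← Submodule.map_span, hSspan, Submodule.map_comap_eq,
      inf_eq_right.2 hrange]

end Normalization

/-! ### The monomial structure forced by `O₂(G⁺)` -/

section MonomialStructure

/-- If `O₂(G⁺)` is elementary abelian of order `2 ^ (p - 1)`, it is the group of all sign changes of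
determinant `1` on some basis of `ℚ ^ p`. Being normalized by `G`, it makes `G` monomial on this
basis. -/
theorem exists_monomial_basis {p : ℕ} (hodd : Odd p) {G : Subgroup (GL (Fin p) ℤ)}
    (hA : IsElementaryAbelian 2 (pCore 2 (plusPart G)))
    (hcard : Nat.card (pCore 2 (plusPart G)) = 2 ^ (p - 1)) :
    ∃ b : Module.Basis (Fin p) ℚ (Fin p → ℚ),
      (∀ i, ∃ g ∈ G, rationalAction p g (b i) = b i ∧ ∀ j ≠ i, rationalAction p g (b j) = -b j) ∧
        ∀ (g : G) i, ∃ j, ∃ a : ℚ, rationalRep G g (b i) = a • b j := by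
  obtain ⟨hcomm, hsq⟩ := hA
  have hcardN : Nat.card (plusCore G) = 2 ^ (p - 1) := by
    rw [← hcard]
    exact Nat.card_congr
      ((pCore 2 (plusPart G)).equivMapOfInjective _ (plusPart G).subtype_injective).symm.toEquiv
  have hNle : plusCore G ≤ plusPart G := Subgroup.map_subtype_le _
  have hNG : plusCore G ≤ G := hNle.trans inf_le_left
  have hNdet : ∀ g ∈ plusCore G, (g : Matrix (Fin p) (Fin p) ℤ).det = 1 := fun g hg =>
    congrArg Units.val (MonoidHom.mem_ker.1 (hNle hg).2)
  have hNcomm : ∀ g ∈ plusCore G, ∀ h ∈ plusCore G, g * h = h * g := by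
    rintro _ ⟨x, hx, rfl⟩ _ ⟨y, hy, rfl⟩
    rw [← map_mul, ← map_mul]
    exact congrArg _ (congrArg Subtype.val (hcomm ⟨x, hx⟩ ⟨y, hy⟩))
  have hNsq : ∀ g ∈ plusCore G, g * g = 1 := by
    rintro _ ⟨x, hx, rfl⟩
    rw [← map_mul, ← pow_two]
    exact (congrArg _ (congrArg Subtype.val (hsq ⟨x, hx⟩))).trans (map_one _)
  have hNfin : (plusCore G : Set (GL (Fin p) ℤ)).Finite :=
    Nat.finite_of_card_ne_zero (by rw [SetLike.coe_sort_coe, hcardN]; positivity)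
  have hspan := span_common_eigenvectors (hNfin.image (rationalAction p)).toFinset
    (by
      intro f hf
      obtain ⟨g, hg, rfl⟩ := (Set.Finite.mem_toFinset _).1 hf
      rw [← map_mul, hNsq g hg, map_one])
    (by
      intro f hf f' hf'
      obtain ⟨g, hg, rfl⟩ := (Set.Finite.mem_toFinset _).1 hf
      obtain ⟨g', hg', rfl⟩ := (Set.Finite.mem_toFinset _).1 hf'
      rw [← map_mul, hNcomm g hg g' hg', map_mul])
  obtain ⟨b, hb⟩ := exists_basis_of_span_eq_top (Pi.basisFun ℚ (Fin p)) hspan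
  replace hb : ∀ g ∈ plusCore G, ∀ i,
      rationalAction p g (b i) = b i ∨ rationalAction p g (b i) = -b i := fun g hg i =>
    hb i _ ((Set.Finite.mem_toFinset _).2 ⟨g, hg, rfl⟩)
  have hsign := exists_sign_change hodd hNdet hcardN b hb
  -- `G` normalizes the sign group, so permutes its common eigenlines
  have hline : ∀ (g : G) i, ∃ j, ∃ a : ℚ, rationalRep G g (b i) = a • b j := fun g i => by
    refine exists_smul_of_common_eigenvector b (F := rationalAction p '' plusCore G)
      (fun i => ?_) ?_ ?_
    · obtain ⟨n, hn, hn'⟩ := hsign i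
      exact ⟨_, ⟨n, hn, rfl⟩, hn'⟩
    · intro h0
      have h1 := (rationalRep G).inv_self_apply g (b i)
      rw [h0, map_zero] at h1
      exact b.ne_zero i h1.symm
    · rintro _ ⟨n, hn, rfl⟩
      have h1 : rationalAction p n (rationalAction p g (b i)) =
          rationalAction p g (rationalAction p ((g : GL (Fin p) ℤ)⁻¹ * n * (g : GL (Fin p) ℤ))
            (b i)) := by
        rw [← Module.End.mul_apply, ← Module.End.mul_apply, ← map_mul, ← map_mul]
        congr 2; group
      have h2 := conj_mem_plusCore (G.inv_mem g.2) hn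
      rw [inv_inv] at h2
      change rationalAction p n (rationalAction p g (b i)) = rationalAction p g (b i) ∨
        rationalAction p n (rationalAction p g (b i)) = -rationalAction p g (b i)
      rw [h1]
      rcases hb _ h2 i with h | h
      · left; rw [h]
      · right; rw [h, map_neg]
  refine ⟨b, fun i => ?_, hline⟩
  obtain ⟨n, hn, hn'⟩ := hsign i
  exact ⟨n, hNG hn, hn'⟩

end MonomialStructure

end SymRank

theorem mainTheorem10 (p : ℕ) (hp : p.Prime) (hp7 : 7 ≤ p)
    (h2 : IsPrimitiveRoot (2 : ZMod p) (p - 1))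
    (G : Subgroup (GL (Fin p) ℤ)) (hfin : Finite G)
    (hirr : SymRank.IsIrreducibleGroup G) (hA : SymRank.PleskenCaseA G)
    (L : Submodule ℤ (Fin p → ℤ)) (hL : SymRank.IsStable G (L : Set (Fin p → ℤ))) :
    SymRank.symrank L G ≤ 2 ^ p := by
  open SymRank in
  rcases eq_or_ne L ⊥ with rfl | hL0
  · refine (iInf₂_le ∅ ⟨fun _ _ _ h => h.elim, Submodule.span_empty⟩).trans ?_
    simp
  have hodd : Odd p := hp.odd_of_ne_two (by omega)
  obtain ⟨hab, l, hl1, hl2, hcard⟩ := hA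
  -- the order of `2` modulo `p` is `p - 1`, which leaves only `l = 1`
  rw [← h2.eq_orderOf, Nat.div_self (by omega)] at hl2
  rw [show l = 1 by omega, mul_one, ← h2.eq_orderOf] at hcard
  obtain ⟨b, hsign, hline⟩ := exists_monomial_basis hodd hab hcard
  have : (rationalRep G).IsIrreducible := hirr
  obtain ⟨τ, c, hτ, e, u, hu⟩ := exists_cyclic_basis (rationalRep G) b
    ((rationalAction_injective p).comp Subtype.val_injective) hp hodd (by simp) hline
  refine symrank_le_of_monomial hp hp7 h2 hL hL0 c (fun g k => ?_) (fun k => ?_) τ.2 hτ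
  · obtain ⟨j, a, ha⟩ := hline g (e k)
    refine ⟨e.symm j, u k * a * (u (e.symm j))⁻¹, ?_⟩
    rw [(hu k).2, map_smul, ha, (hu (e.symm j)).2, e.apply_symm_apply, smul_smul, smul_smul,
      inv_mul_cancel_right₀ (hu _).1]
  · obtain ⟨n, hn, hnk, hnj⟩ := hsign (e k)
    refine ⟨n, hn, by rw [(hu k).2, map_smul, hnk], fun j hj => ?_⟩
    rw [(hu j).2, map_smul, hnj _ (e.injective.ne hj), smul_neg]
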